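/- \textbf{Theorem (Characterization of non-degenerate MDPs).} Let $M=(S,(A(s))_{s\in S},r,p)$ be a Markov decision process with a finite non-empty state space $S$, finite non-empty action sets $A(s)$, set of pairs $Z=\{(s,a): s\in S,\ a\in A(s)\}$, mean reward function $r:Z\to\mathbb{R}$ and transition kernel $p$, where $p(s,a)$ is a probability distribution on $S$ and $p(s,a)u:=\sum_{s'}p(s'\mid s,a)u(s')$ for $u\in\mathbb{R}^S$. A policy is a map $\pi$ with $\pi(s)\in A(s)$ for all $s$. Under $\pi$ and from $S_1=s$, let $S_t$ be the state at time $t$ and $R_t$ the reward, of mean $r(S_t,\pi(S_t))$ given $S_t$; put $$g^\pi(s)=\lim_{T\to\infty}\frac1T\,\mathbb{E}^\pi_s\Big[\sum_{t=1}^T R_t\Big],\qquad h^\pi(s)=\operatorname*{C-lim}_{T\to\infty}\mathbb{E}^\pi_s\Big[\sum_{t=1}^T\big(R_t-g^\pi(S_t)\big)\Big],$$ where $\operatorname{C-lim}$ is the limit in the sense of Ces\`aro. Let $g^*(s)=\max_\pi g^\pi(s)$, and let $h^*(s)$ be the maximum of $h^\pi(s)$ over the policies $\pi$ with $g^\pi=g^*$.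 A pair $(s,a)$ is weakly-optimal if $g^*(s)+h^*(s)-r(s,a)-p(s,a)h^*=0$; denote by $\mathcal{Z}^{**}(r,p)$ the set of weakly-optimal pairs. Assume that $M$ is communicating, i.e. $$\max_{s\ne s'}\min_\pi\mathbb{E}^\pi_s\big[\inf\{t\ge1:S_t=s'\}\big]<\infty .$$ Then the following two statements are equivalent. 1. $M$ is non-degenerate: there is a unique policy $\pi$ such that, for all $s\in S$, $$g^\pi(s)=\max_{a\in A(s)}p(s,a)g^\pi\quad\text{and}\quad g^\pi(s)+h^\pi(s)=\max_{a\in A(s)}\{r(s,a)+p(s,a)h^\pi\},$$ and this policy is unichain, i.e. the Markov chain that it induces on $S$ has exactly one recurrent class. 2. There is $\epsilon>0$ such that, for all $r':Z\to\mathbb{R}$ with $\|r'-r\|_\infty<\epsilon$, one has $\mathcal{Z}^{**}(r',p)=\mathcal{Z}^{**}(r,p)$. -/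

import Mathlib

open Filter Topology
open scoped Matrix ENNReal

/-- A finite Markov decision process with state space `S` and action set `A s` available in state
`s`. The state-action pairs are the elements of `Σ s, A s`; `r z` is the mean reward of the pair
`z` and `p z` is the distribution of the next state after `z`. -/
structure MDP (S : Type*) [Fintype S] (A : S → Type*) where
  r : (Σ s, A s) → ℝ
  p : (Σ s, A s) → S → ℝ
  p_nonneg : ∀ z s', 0 ≤ p z s'
  p_sum : ∀ z, ∑ s', p z s' = 1

namespace MDP

/-- Stationary deterministic policies. -/
abbrev Policy {S : Type*} (A : S → Type*) : Type _ := ∀ s, A s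

/-- The limit in the sense of Cesàro of `u 1, u 2, …`. -/
noncomputable def cesaroLim (u : ℕ → ℝ) : ℝ :=
  limUnder atTop (fun N : ℕ => (1 / (N : ℝ)) * ∑ T ∈ Finset.Icc 1 N, u T)

variable {S : Type*} [Fintype S] {A : S → Type*}

/-- The same model with another (mean) reward function. -/
def withReward (M : MDP S A) (r' : (Σ s, A s) → ℝ) : MDP S A := { M with r := r' }

/-- The expectation `p(z) u` of `u` at the state that follows the pair `z`. -/
def next (M : MDP S A) (z : Σ s, A s) (u : S → ℝ) : ℝ := ∑ s', M.p z s' * u s'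

/-- The transition matrix of the Markov chain of states induced by a policy. -/
def trans (M : MDP S A) (π : Policy A) : Matrix S S ℝ := Matrix.of fun s s' => M.p ⟨s, π s⟩ s'

/-- The mean reward in each state under a policy. -/
def policyReward (M : MDP S A) (π : Policy A) : S → ℝ := fun s => M.r ⟨s, π s⟩

variable [DecidableEq S]

/-- `M.expect π s t f` is the expectation of `f (S_t)` for `t ≥ 1`, when the first state is
`S_1 = s` and actions follow `π`: the law of `S_t` is row `s` of the `(t - 1)`-th power of the
transition matrix. -/
noncomputable def expect (M : MDP S A) (π : Policy A) (s : S) (t : ℕ) (f : S → ℝ) : ℝ :=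
  ((M.trans π ^ (t - 1)) *ᵥ f) s

/-- The gain: `lim_T (1/T) E_s^π [R_1 + ⋯ + R_T]`. -/
noncomputable def gain (M : MDP S A) (π : Policy A) (s : S) : ℝ :=
  limUnder atTop (fun T : ℕ =>
    (1 / (T : ℝ)) * ∑ t ∈ Finset.Icc 1 T, M.expect π s t (M.policyReward π))

/-- The bias: the Cesàro limit of `E_s^π [∑_{t ≤ T} (R_t - gain(S_t))]`. -/
noncomputable def bias (M : MDP S A) (π : Policy A) (s : S) : ℝ :=
  cesaroLim (fun T => ∑ t ∈ Finset.Icc 1 T,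
    M.expect π s t (fun x => M.policyReward π x - M.gain π x))

/-- The optimal gain, a maximum over the finitely many policies. -/
noncomputable def optGain (M : MDP S A) (s : S) : ℝ := ⨆ π : Policy A, M.gain π s

/-- Gain optimal policies. -/
def GainOptimal (M : MDP S A) (π : Policy A) : Prop := ∀ s, M.gain π s = M.optGain s

/-- The optimal bias, a maximum over the gain optimal policies. -/
noncomputable def optBias (M : MDP S A) (s : S) : ℝ :=
  ⨆ π : {π : Policy A // M.GainOptimal π}, M.bias π.1 s

/-- The Bellman gap of a pair. -/
noncomputable def gap (M : MDP S A) (z : Σ s, A s) : ℝ :=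
  M.optGain z.1 + M.optBias z.1 - M.r z - M.next z M.optBias

/-- The set of weakly-optimal pairs. -/
def weaklyOptimalPairs (M : MDP S A) : Set (Σ s, A s) := {z | M.gap z = 0}

/-- The probability that `S_1, …, S_n` all differ from `target`, when `S_1` is the last argument
and actions follow `π`. -/
noncomputable def avoidProb (M : MDP S A) (π : Policy A) (target : S) : ℕ → S → ℝ
  | 0, _ => 1
  | n + 1, s => if s = target then 0 else M.next ⟨s, π s⟩ (M.avoidProb π target n)

/-- The expectation of `τ = inf {t ≥ 1 : S_t = target}` from `S_1 = s` under `π`, written as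
`∑ n, Prob (τ > n)`. -/
noncomputable def expectedHittingTime (M : MDP S A) (π : Policy A) (s target : S) : ℝ≥0∞ :=
  ∑' n : ℕ, ENNReal.ofReal (M.avoidProb π target n s)

/-- The diameter. -/
noncomputable def diameter (M : MDP S A) : ℝ≥0∞ :=
  ⨆ (s : S) (s' : S) (_ : s ≠ s'), ⨅ π : Policy A, M.expectedHittingTime π s s'

/-- The model is communicating: its diameter is finite. -/
def Communicating (M : MDP S A) : Prop := M.diameter < ⊤

/-- `s'` is accessible from `s` in the Markov chain induced by `π`. -/
def Accessible (M : MDP S A) (π : Policy A) (s s' : S) : Prop :=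
  ∃ n : ℕ, 0 < (M.trans π ^ n) s s'

/-- Recurrent classes of the (finite) chain induced by `π`: nonempty sets of states that are closed
and all of whose states are accessible from each other. -/
def IsRecurrentClass (M : MDP S A) (π : Policy A) (C : Set S) : Prop :=
  C.Nonempty ∧ ∀ s ∈ C, ∀ s', M.Accessible π s s' ↔ s' ∈ C

/-- A policy is unichain if its chain has exactly one recurrent class (transient states are
allowed). -/
def Unichain (M : MDP S A) (π : Policy A) : Prop := ∃! C : Set S, M.IsRecurrentClass π C

/-- The first two Bellman optimality equations for the gain and bias of a policy. -/
def BellmanOptimal (M : MDP S A) (π : Policy A) : Prop :=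
  (∀ s, M.gain π s = ⨆ a : A s, M.next ⟨s, a⟩ (M.gain π)) ∧
  (∀ s, M.gain π s + M.bias π s = ⨆ a : A s, (M.r ⟨s, a⟩ + M.next ⟨s, a⟩ (M.bias π)))

/-- Non-degeneracy: there is a unique Bellman optimal policy, and it is unichain. -/
def NonDegenerate (M : MDP S A) : Prop :=
  ∃ π : Policy A, M.BellmanOptimal π ∧ (∀ π' : Policy A, M.BellmanOptimal π' → π' = π) ∧
    M.Unichain π

end MDP

/-! Attach to each policy its own gap g^π + h^π - r - p h^π, zero on the graph of π. If π is
unichain and its gap is positive off the graph, then π is the only Bellman optimal policy and the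
weakly-optimal pairs are exactly the graph (`Communicating.nonDegenerate_of_policyGap_pos`). For
fixed π, gain and bias are linear in the reward, so this positivity survives small perturbations.

Both directions use `Communicating.policyGap_pos_of_unique`: if only one unichain policy has
nonnegative gap, that gap is positive off its graph. Its core is
`Communicating.exists_isUniqueClass`, which turns any recurrent class made of tight pairs into the
only class of some optimal policy: reward the class by δ, solve the optimality equation, and let δ →
0 with finitely many policies.

From 1 to 2, uniqueness gives positivity, which is stable. From 2 to 1, a small bonus on the graph
of any unichain policy with nonnegative gap makes that graph the weakly-optimal set, so by stability
it already was; hence there is only one such policy. Existence comes from vanishing discount. -/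

namespace MDP

/-! ### Averaging under the transition kernel -/

section Next

variable {S : Type*} [Fintype S] {A : S → Type*} (M : MDP S A)

theorem next_sub (z : Σ s, A s) (u v : S → ℝ) : M.next z (u - v) = M.next z u - M.next z v := by
  simp [next, mul_sub, Finset.sum_sub_distrib]

theorem next_neg (z : Σ s, A s) (u : S → ℝ) : M.next z (-u) = -M.next z u := by
  simp [next]

theorem next_const (z : Σ s, A s) (c : ℝ) : M.next z (fun _ => c) = c := by
  simp [next, ← Finset.sum_mul, M.p_sum]

theorem next_mono (z : Σ s, A s) {u v : S → ℝ} (h : ∀ s, u s ≤ v s) :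
    M.next z u ≤ M.next z v :=
  Finset.sum_le_sum fun s _ => mul_le_mul_of_nonneg_left (h s) (M.p_nonneg z s)

theorem continuous_next (z : Σ s, A s) : Continuous (M.next z) := by
  unfold next; fun_prop

theorem le_next {z : Σ s, A s} {u : S → ℝ} {c : ℝ} (h : ∀ s, 0 < M.p z s → c ≤ u s) :
    c ≤ M.next z u := by
  rw [← M.next_const z c]
  refine Finset.sum_le_sum fun s _ => ?_
  rcases (M.p_nonneg z s).eq_or_lt with h0 | h0
  · simp [← h0]
  · exact mul_le_mul_of_nonneg_left (h s h0) h0.le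

theorem eq_of_next_le {z : Σ s, A s} {u : S → ℝ} {c : ℝ} (h : ∀ s, 0 < M.p z s → c ≤ u s)
    (hc : M.next z u ≤ c) (s : S) (hs : 0 < M.p z s) : u s = c := by
  have key : ∀ t ∈ Finset.univ, 0 ≤ M.p z t * (u t - c) := fun t _ => by
    rcases (M.p_nonneg z t).eq_or_lt with h0 | h0
    · simp [← h0]
    · exact mul_nonneg h0.le (sub_nonneg.2 (h t h0))
  have hsum : ∑ t, M.p z t * (u t - c) = M.next z u - c := by
    have := M.next_sub z u (fun _ => c)
    rw [M.next_const] at this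
    exact this
  have h0 := (Finset.sum_eq_zero_iff_of_nonneg key).1
    (le_antisymm (by linarith) (Finset.sum_nonneg key)) s (Finset.mem_univ s)
  rcases mul_eq_zero.1 h0 with h1 | h1
  · exact absurd h1 hs.ne'
  · linarith

end Next

/-! ### Minimum principles and recurrent classes -/

section Chain

variable {S : Type*} [Fintype S] {A : S → Type*} (M : MDP S A)

theorem trans_mulVec (π : Policy A) (f : S → ℝ) (s : S) :
    (M.trans π *ᵥ f) s = M.next ⟨s, π s⟩ f := rfl

/-- A set of states that the chain induced by `π` cannot leave. -/
def IsClosedUnder (π : Policy A) (D : Set S) : Prop :=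
  ∀ s ∈ D, ∀ s', 0 < M.p ⟨s, π s⟩ s' → s' ∈ D

variable {M} {π : Policy A} {D : Set S}

theorem IsClosedUnder.setOf_min (hD : M.IsClosedUnder π D) {f : S → ℝ}
    (hf : ∀ s ∈ D, M.next ⟨s, π s⟩ f ≤ f s) {x : S} (hx : ∀ y ∈ D, f x ≤ f y) :
    M.IsClosedUnder π {s | s ∈ D ∧ f s = f x} := by
  rintro s ⟨hs, hsx⟩ s' hs'
  exact ⟨hD s hs s' hs', M.eq_of_next_le (fun t ht => hx t (hD s hs t ht))
    (hsx ▸ hf s hs) s' hs'⟩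

/-- At a minimiser of `f` over `D` the next state still lies in `D`, so `f` cannot decrease on
average there. -/
theorem IsClosedUnder.drift_nonpos (hD : M.IsClosedUnder π D) (hne : D.Nonempty) {f : S → ℝ}
    {c : ℝ} (hf : ∀ s ∈ D, c ≤ f s - M.next ⟨s, π s⟩ f) : c ≤ 0 := by
  obtain ⟨x, hx, hmin⟩ := Set.exists_min_image D f D.toFinite hne
  have h1 := hf x hx
  have h2 : f x ≤ M.next ⟨x, π x⟩ f := M.le_next fun t ht => hmin t (hD x hx t ht)
  linarith

theorem isClosedUnder_univ : M.IsClosedUnder π Set.univ := fun _ _ _ _ => trivial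

/-- The maximisers of a harmonic `q` form a closed set on which `q` is constant; `drift_nonpos`
bounds this constant. -/
theorem nonpos_of_le_sub_next {q f : S → ℝ} (hq : ∀ s, M.next ⟨s, π s⟩ q = q s)
    (hf : ∀ s, q s ≤ f s - M.next ⟨s, π s⟩ f) (s : S) : q s ≤ 0 := by
  obtain ⟨x, -, hmax⟩ := Set.exists_min_image Set.univ (-q) Set.finite_univ ⟨s, trivial⟩
  have hcl := (isClosedUnder_univ (M := M) (π := π)).setOf_min (f := -q)
    (fun t _ => by rw [M.next_neg, hq]; rfl) hmax
  have hx : q x ≤ 0 := hcl.drift_nonpos (f := f) ⟨x, trivial, rfl⟩ fun t ht => by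
    have h1 := hf t
    have h2 : (-q) t = (-q) x := ht.2
    simp only [Pi.neg_apply] at h2
    linarith
  have := hmax s trivial
  simp only [Pi.neg_apply] at this
  linarith

theorem trans_nonneg (s s' : S) : 0 ≤ M.trans π s s' := M.p_nonneg _ _

variable [DecidableEq S]

theorem Accessible.refl (s : S) : M.Accessible π s s := ⟨0, by simp⟩

theorem trans_pow_nonneg (n : ℕ) (s s' : S) : 0 ≤ (M.trans π ^ n) s s' := by
  induction n generalizing s' with
  | zero => simp only [pow_zero, Matrix.one_apply]; split_ifs <;> norm_num
  | succ n ih =>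
    rw [pow_succ, Matrix.mul_apply]
    exact Finset.sum_nonneg fun t _ => mul_nonneg (ih t) (trans_nonneg t s')

theorem Accessible.trans {a b c : S} (h₁ : M.Accessible π a b) (h₂ : M.Accessible π b c) :
    M.Accessible π a c := by
  obtain ⟨m, hm⟩ := h₁
  obtain ⟨n, hn⟩ := h₂
  refine ⟨m + n, ?_⟩
  rw [pow_add, Matrix.mul_apply]
  exact (mul_pos hm hn).trans_le (Finset.single_le_sum
    (f := fun t => (M.trans π ^ m) a t * (M.trans π ^ n) t c)
    (fun t _ => mul_nonneg (trans_pow_nonneg m a t) (trans_pow_nonneg n t c))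
    (Finset.mem_univ b))

theorem accessible_of_pos {s s' : S} (h : 0 < M.p ⟨s, π s⟩ s') : M.Accessible π s s' :=
  ⟨1, by simpa [MDP.trans] using h⟩

theorem IsClosedUnder.mem_of_accessible (hD : M.IsClosedUnder π D) {s s' : S} (hs : s ∈ D)
    (h : M.Accessible π s s') : s' ∈ D := by
  obtain ⟨n, hn⟩ := h
  induction n generalizing s' with
  | zero =>
    rw [pow_zero, Matrix.one_apply] at hn
    split_ifs at hn with h
    · exact h ▸ hs
    · exact absurd hn (lt_irrefl 0)
  | succ n ih =>
    rw [pow_succ, Matrix.mul_apply] at hn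
    obtain ⟨t, -, ht⟩ := Finset.exists_lt_of_sum_lt (f := fun _ => (0 : ℝ)) (by simpa using hn)
    have h1 : 0 < (M.trans π ^ n) s t :=
      (trans_pow_nonneg n s t).lt_of_ne fun h0 => by simp [← h0] at ht
    exact hD t (ih h1) s' (pos_of_mul_pos_right ht h1.le)

theorem IsRecurrentClass.isClosedUnder {C : Set S} (hC : M.IsRecurrentClass π C) :
    M.IsClosedUnder π C :=
  fun s hs s' h => (hC.2 s hs s').1 (accessible_of_pos h)

theorem IsRecurrentClass.subset_of_mem {C : Set S} (hC : M.IsRecurrentClass π C) {s : S}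
    (hs : s ∈ C) (hD : M.IsClosedUnder π D) (hsD : s ∈ D) : C ⊆ D :=
  fun s' h => hD.mem_of_accessible hsD ((hC.2 s hs s').2 h)

/-- A state whose accessible set has least cardinality is accessible from every state it reaches. -/
theorem IsClosedUnder.exists_isRecurrentClass (hD : M.IsClosedUnder π D) (hne : D.Nonempty) :
    ∃ C ⊆ D, M.IsRecurrentClass π C := by
  obtain ⟨s, hs, hmin⟩ := Set.exists_min_image D (fun s => {s' | M.Accessible π s s'}.ncard)
    D.toFinite hne
  refine ⟨{s' | M.Accessible π s s'}, fun s' h => hD.mem_of_accessible hs h,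
    ⟨s, Accessible.refl s⟩, fun x hx y => ?_⟩
  have hsub : {y | M.Accessible π x y} ⊆ {y | M.Accessible π s y} :=
    fun y hy => Accessible.trans hx hy
  have := Set.eq_of_subset_of_ncard_le hsub (hmin x (hD.mem_of_accessible hs hx))
  exact Set.ext_iff.1 this y

theorem IsClosedUnder.exists_isRecurrentClass_min (hD : M.IsClosedUnder π D) (hne : D.Nonempty)
    {f : S → ℝ} (hf : ∀ s ∈ D, M.next ⟨s, π s⟩ f ≤ f s) :
    ∃ C ⊆ D, M.IsRecurrentClass π C ∧ ∀ c ∈ C, ∀ x ∈ D, f c ≤ f x := by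
  obtain ⟨x, hx, hmin⟩ := Set.exists_min_image D f D.toFinite hne
  obtain ⟨C, hCD, hC⟩ := (hD.setOf_min hf hmin).exists_isRecurrentClass ⟨x, hx, rfl⟩
  exact ⟨C, fun c hc => (hCD hc).1, hC, fun c hc y hy => (hCD hc).2.trans_le (hmin y hy)⟩

theorem IsRecurrentClass.eq_of_next_le {C : Set S} (hC : M.IsRecurrentClass π C) {f : S → ℝ}
    (hf : ∀ s ∈ C, M.next ⟨s, π s⟩ f ≤ f s) {x y : S} (hx : x ∈ C) (hy : y ∈ C) : f x = f y := by
  obtain ⟨C', hCC', hC', hmin⟩ := hC.isClosedUnder.exists_isRecurrentClass_min hC.1 hf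
  obtain ⟨s, hs⟩ := hC'.1
  have hsub := hC.subset_of_mem (hCC' hs) hC'.isClosedUnder hs
  exact le_antisymm (hmin x (hsub hx) y hy) (hmin y (hsub hy) x hx)

/-- The set `C` is the only recurrent class of the chain induced by `π`. -/
def IsUniqueClass (M : MDP S A) (π : Policy A) (C : Set S) : Prop :=
  M.IsRecurrentClass π C ∧ ∀ C', M.IsRecurrentClass π C' → C' = C

theorem IsUniqueClass.unichain {C : Set S} (h : M.IsUniqueClass π C) : M.Unichain π :=
  ⟨C, h.1, h.2⟩

theorem Unichain.exists_isUniqueClass (h : M.Unichain π) : ∃ C, M.IsUniqueClass π C := h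

/-- A superharmonic function attains its minimum on some recurrent class, and there is only one. -/
theorem IsUniqueClass.le_of_next_le {C : Set S} (h : M.IsUniqueClass π C) {f : S → ℝ}
    (hf : ∀ s, M.next ⟨s, π s⟩ f ≤ f s) {c : S} (hc : c ∈ C) (x : S) : f c ≤ f x := by
  obtain ⟨C', -, hC', hmin⟩ := (isClosedUnder_univ (M := M) (π := π)).exists_isRecurrentClass_min
    ⟨x, trivial⟩ (fun s _ => hf s)
  exact hmin c (h.2 C' hC' ▸ hc) x trivial

theorem Unichain.eq_const (h : M.Unichain π) {f : S → ℝ} (hf : ∀ s, M.next ⟨s, π s⟩ f = f s) :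
    ∃ c, f = fun _ => c := by
  obtain ⟨C, hC⟩ := h.exists_isUniqueClass
  obtain ⟨c, hc⟩ := hC.1.1
  refine ⟨f c, funext fun x => le_antisymm ?_ (hC.le_of_next_le (fun s => (hf s).le) hc x)⟩
  have := hC.le_of_next_le (f := -f) (fun s => by rw [M.next_neg, hf]; rfl) hc x
  simpa using this

end Chain

/-! ### Evaluation equations for gain and bias -/

section GainBias

variable {S : Type*} [Fintype S] [DecidableEq S] {A : S → Type*} (M : MDP S A) (π : Policy A)

theorem expect_succ (s : S) (t : ℕ) (f : S → ℝ) :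
    M.expect π s (t + 1) f = ((M.trans π ^ t) *ᵥ f) s := rfl

theorem abs_trans_pow_mulVec_le {f : S → ℝ} {B : ℝ} (hf : ∀ s, |f s| ≤ B) (n : ℕ) (s : S) :
    |((M.trans π ^ n) *ᵥ f) s| ≤ B := by
  induction n generalizing s with
  | zero => simpa using hf s
  | succ n ih =>
    rw [pow_succ', ← Matrix.mulVec_mulVec, trans_mulVec, abs_le]
    refine ⟨M.le_next fun t _ => (abs_le.1 (ih t)).1, ?_⟩
    rw [← M.next_const ⟨s, π s⟩ B]
    exact M.next_mono _ fun t => (abs_le.1 (ih t)).2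

theorem trans_pow_mulVec_eq {k : S → ℝ} (hk : M.trans π *ᵥ k = k) (n : ℕ) :
    (M.trans π ^ n) *ᵥ k = k := by
  induction n with
  | zero => simp
  | succ n ih => rw [pow_succ, ← Matrix.mulVec_mulVec, hk, ih]

theorem sum_expect {k : S → ℝ} (hk : M.trans π *ᵥ k = k) (y : S → ℝ) (s : S) (T : ℕ) :
    ∑ t ∈ Finset.Icc 1 T, M.expect π s t (k + (y - M.trans π *ᵥ y)) =
      T * k s + (y s - ((M.trans π ^ T) *ᵥ y) s) := by
  induction T with
  | zero => simp
  | succ T ih =>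
    rw [Finset.sum_Icc_succ_top (by lia), ih, expect_succ, Matrix.mulVec_add,
      trans_pow_mulVec_eq M π hk, Matrix.mulVec_sub, Matrix.mulVec_mulVec, ← pow_succ]
    simp only [Pi.add_apply, Pi.sub_apply]
    push_cast
    ring

theorem tendsto_average_expect {k : S → ℝ} (hk : M.trans π *ᵥ k = k) (y : S → ℝ) (s : S) :
    Tendsto (fun T : ℕ => (1 / (T : ℝ)) *
      ∑ t ∈ Finset.Icc 1 T, M.expect π s t (k + (y - M.trans π *ᵥ y))) atTop (𝓝 (k s)) := by
  have hB : ∀ x, |y x| ≤ ‖y‖ := fun x => norm_le_pi_norm y x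
  have h0 : Tendsto (fun T : ℕ => (1 / (T : ℝ)) * (y s - ((M.trans π ^ T) *ᵥ y) s)) atTop
      (𝓝 0) := by
    refine bdd_le_mul_tendsto_zero' (2 * ‖y‖) (Eventually.of_forall fun T => ?_)
      tendsto_one_div_atTop_nhds_zero_nat |>.congr fun T => mul_comm _ _
    have := abs_le.1 (abs_trans_pow_mulVec_le M π hB T s)
    have := abs_le.1 (hB s)
    exact abs_le.2 ⟨by linarith, by linarith⟩
  have h1 := h0.const_add (k s)
  rw [add_zero] at h1
  refine h1.congr' ?_
  filter_upwards [eventually_gt_atTop 0] with T hT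
  have : (T : ℝ) ≠ 0 := by positivity
  rw [sum_expect M π hk]
  field_simp

/-- The gain and the bias are determined by the evaluation equations and the condition that the
bias lies in the range of `1 - P`. -/
theorem gain_bias_eq {g h w : S → ℝ} (hg : M.trans π *ᵥ g = g)
    (hr : M.policyReward π = g + (h - M.trans π *ᵥ h)) (hh : h = w - M.trans π *ᵥ w) :
    M.gain π = g ∧ M.bias π = h := by
  have hgain : M.gain π = g := by
    funext s
    refine Tendsto.limUnder_eq ?_
    rw [hr]
    exact tendsto_average_expect M π hg h s
  refine ⟨hgain, funext fun s => Tendsto.limUnder_eq ?_⟩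
  have hdiff : (fun x => M.policyReward π x - M.gain π x) =
      0 + (h - M.trans π *ᵥ h) := by
    funext x
    rw [hgain, hr]
    simp
  have hP0 : M.trans π *ᵥ (0 : S → ℝ) = 0 := Matrix.mulVec_zero _
  -- The partial sums are h - P^T h, and h = w - P w makes P^T h average to zero. The argument is `P
  -- w` rather than `w` because `expect` at time `T` applies only P^(T-1).
  have key := (tendsto_average_expect M π hP0 (M.trans π *ᵥ w) s).const_sub (h s)
  simp only [Pi.zero_apply, sub_zero] at key
  refine key.congr' ?_
  filter_upwards [eventually_gt_atTop 0] with N hN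
  have hN' : (N : ℝ) ≠ 0 := by positivity
  have hterm : ∀ T ∈ Finset.Icc 1 N,
      ∑ t ∈ Finset.Icc 1 T, M.expect π s t (fun x => M.policyReward π x - M.gain π x) =
        h s - M.expect π s T (0 + (M.trans π *ᵥ w - M.trans π *ᵥ (M.trans π *ᵥ w))) := by
    intro T hT
    obtain ⟨n, rfl⟩ : ∃ n, T = n + 1 := ⟨T - 1, by have := (Finset.mem_Icc.1 hT).1; lia⟩
    rw [hdiff, sum_expect M π hP0, expect_succ, zero_add, ← Matrix.mulVec_sub, ← hh,
      Matrix.mulVec_mulVec, ← pow_succ]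
    simp
  rw [Finset.sum_congr rfl hterm, Finset.sum_sub_distrib]
  simp only [Finset.sum_const, Nat.card_Icc, add_tsub_cancel_right, nsmul_eq_mul]
  field_simp

-- The kernel and the range of 1 - P meet only in 0, by `nonpos_of_le_sub_next` applied to a common
-- element and its negative; rank-nullity then makes them complementary.
omit [DecidableEq S] in
theorem exists_eq_add_sub (f : S → ℝ) :
    ∃ k y : S → ℝ, M.trans π *ᵥ k = k ∧ f = k + (y - M.trans π *ᵥ y) := by
  set L : (S → ℝ) →ₗ[ℝ] (S → ℝ) := LinearMap.id - (M.trans π).mulVecLin with hL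
  have hLy : ∀ y, L y = y - M.trans π *ᵥ y := fun y => rfl
  have hdisj : Disjoint L.ker L.range := by
    rw [Submodule.disjoint_def]
    rintro x hx ⟨y, rfl⟩
    have hx' : M.trans π *ᵥ (L y) = L y := (sub_eq_zero.1 (hLy (L y) ▸ hx)).symm
    have hle := nonpos_of_le_sub_next (M := M) (π := π) (q := L y) (f := y)
      (fun s => congrFun hx' s) (fun s => (congrFun (hLy y) s).le)
    have hge := nonpos_of_le_sub_next (M := M) (π := π) (q := -L y) (f := -y)
      (fun s => by rw [M.next_neg]; exact congrArg Neg.neg (congrFun hx' s))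
      (fun s => by rw [M.next_neg, hLy]; simp [trans_mulVec])
    funext s
    have := hge s
    simp only [Pi.neg_apply] at this
    have h0 : L y s = 0 := le_antisymm (hle s) (by linarith)
    exact h0
  have hcompl : IsCompl L.ker L.range := by
    refine (Submodule.isCompl_iff_disjoint _ _ ?_).2 hdisj
    rw [add_comm, L.finrank_range_add_finrank_ker]
  obtain ⟨k, hk, l, ⟨y, rfl⟩, hf⟩ := Submodule.mem_sup.1
    (hcompl.sup_eq_top ▸ Submodule.mem_top : f ∈ L.ker ⊔ L.range)
  exact ⟨k, y, (sub_eq_zero.1 (hLy k ▸ hk)).symm, hf.symm⟩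

/-- The evaluation equations for the gain and the bias of a policy. -/
theorem gain_bias_spec : M.trans π *ᵥ M.gain π = M.gain π ∧
    M.policyReward π = M.gain π + (M.bias π - M.trans π *ᵥ M.bias π) ∧
    ∃ w, M.bias π = w - M.trans π *ᵥ w := by
  obtain ⟨g, y, hg, hr⟩ := exists_eq_add_sub M π (M.policyReward π)
  -- A second decomposition removes the harmonic part of `y`, which normalises it to the bias.
  obtain ⟨k, w, hk, hy⟩ := exists_eq_add_sub M π y
  have hr' : M.policyReward π = g + ((w - M.trans π *ᵥ w) -
      M.trans π *ᵥ (w - M.trans π *ᵥ w)) := by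
    have : w - M.trans π *ᵥ w = y - k := by rw [hy]; simp
    rw [this, Matrix.mulVec_sub, hk, hr]
    simp
  obtain ⟨h1, h2⟩ := gain_bias_eq M π hg hr' rfl
  rw [h1, h2]
  exact ⟨hg, hr', w, rfl⟩

theorem next_gain (s : S) : M.next ⟨s, π s⟩ (M.gain π) = M.gain π s :=
  congrFun (gain_bias_spec M π).1 s

theorem gain_add_bias (s : S) :
    M.gain π s + M.bias π s = M.r ⟨s, π s⟩ + M.next ⟨s, π s⟩ (M.bias π) := by
  have := congrFun (gain_bias_spec M π).2.1 s
  simp only [Pi.add_apply, Pi.sub_apply, trans_mulVec, policyReward] at this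
  linarith

variable {M π} in
/-- A solution of the evaluation equations gives the gain, and the bias up to a harmonic function. -/
theorem gain_bias_of_poisson {g h : S → ℝ} (hg : ∀ s, M.next ⟨s, π s⟩ g = g s)
    (hr : ∀ s, g s + h s = M.r ⟨s, π s⟩ + M.next ⟨s, π s⟩ h) :
    M.gain π = g ∧ ∃ k : S → ℝ, (∀ s, M.next ⟨s, π s⟩ k = k s) ∧ M.bias π = h - k := by
  obtain ⟨k, w, hk, hh⟩ := exists_eq_add_sub M π h
  have hb : w - M.trans π *ᵥ w = h - k := by rw [hh]; simp
  obtain ⟨h1, h2⟩ := gain_bias_eq M π (g := g) (h := h - k) (w := w) (funext hg) (by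
    rw [Matrix.mulVec_sub, hk]
    funext s
    have := hr s
    simp only [policyReward, Pi.add_apply, Pi.sub_apply, trans_mulVec]
    linarith) hb.symm
  exact ⟨h1, k, congrFun hk, h2⟩

variable {M π} in
theorem Unichain.gain_bias_of_poisson (hu : M.Unichain π) {g : ℝ} {h : S → ℝ}
    (hr : ∀ s, g + h s = M.r ⟨s, π s⟩ + M.next ⟨s, π s⟩ h) :
    (∀ s, M.gain π s = g) ∧ ∃ k : ℝ, ∀ s, M.bias π s = h s - k := by
  obtain ⟨h1, k, hk, h2⟩ :=
    MDP.gain_bias_of_poisson (g := fun _ => g) (fun s => M.next_const _ g) hr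
  obtain ⟨c, rfl⟩ := hu.eq_const hk
  exact ⟨congrFun h1, c, congrFun h2⟩

variable {M π} in
theorem Unichain.exists_gain_eq (hu : M.Unichain π) : ∃ g : ℝ, ∀ s, M.gain π s = g := by
  obtain ⟨c, hc⟩ := hu.eq_const (next_gain M π)
  exact ⟨c, congrFun hc⟩

/-- The gain and bias of a policy, as a linear function of the reward. -/
noncomputable def gainBiasLinear :
    ((Σ s, A s) → ℝ) →ₗ[ℝ] (S → ℝ) × (S → ℝ) where
  toFun r := ((M.withReward r).gain π, (M.withReward r).bias π)
  map_add' r₁ r₂ := by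
    obtain ⟨a1, a2, w1, a3⟩ := gain_bias_spec (M.withReward r₁) π
    obtain ⟨b1, b2, w2, b3⟩ := gain_bias_spec (M.withReward r₂) π
    have := gain_bias_eq (M.withReward (r₁ + r₂)) π
      (g := (M.withReward r₁).gain π + (M.withReward r₂).gain π)
      (h := (M.withReward r₁).bias π + (M.withReward r₂).bias π) (w := w1 + w2)
      (by rw [Matrix.mulVec_add]; exact congrArg₂ (· + ·) a1 b1)
      (by
        rw [Matrix.mulVec_add]
        refine (congrArg₂ (· + ·) a2 b2).trans ?_
        change _ = _ + (_ - ((M.withReward r₁).trans π *ᵥ _ + (M.withReward r₂).trans π *ᵥ _))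
        abel)
      (by
        rw [Matrix.mulVec_add]
        refine (congrArg₂ (· + ·) a3 b3).trans ?_
        change _ = _ - ((M.withReward r₁).trans π *ᵥ _ + (M.withReward r₂).trans π *ᵥ _)
        abel)
    exact Prod.ext this.1 this.2
  map_smul' c r := by
    obtain ⟨a1, a2, w, a3⟩ := gain_bias_spec (M.withReward r) π
    have := gain_bias_eq (M.withReward (c • r)) π (g := c • (M.withReward r).gain π)
      (h := c • (M.withReward r).bias π) (w := c • w)
      (by rw [Matrix.mulVec_smul]; exact congrArg (c • ·) a1)
      (by
        rw [Matrix.mulVec_smul, ← smul_sub, ← smul_add]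
        exact congrArg (c • ·) a2)
      (by
        rw [Matrix.mulVec_smul, ← smul_sub]
        exact congrArg (c • ·) a3)
    exact Prod.ext this.1 this.2

variable [∀ s, Finite (A s)]

theorem continuous_gainBias : Continuous fun r : (Σ s, A s) → ℝ =>
    ((M.withReward r).gain π, (M.withReward r).bias π) :=
  (gainBiasLinear M π).continuous_of_finiteDimensional

end GainBias

/-! ### The optimality equation by vanishing discount -/

section OptimalityEquation

variable {S : Type*} [Fintype S] {A : S → Type*} (M : MDP S A)

theorem next_eq {z : Σ s, A s} {u : S → ℝ} {c : ℝ} (h : ∀ s, 0 < M.p z s → u s = c) :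
    M.next z u = c := by
  refine le_antisymm ?_ (M.le_next fun s hs => (h s hs).ge)
  have := M.le_next (z := z) (u := -u) (c := -c) fun s hs => by simp [h s hs]
  rw [next_neg] at this
  linarith

-- From a set closed under all actions, a state outside is never hit, whatever the policy, so the
-- diameter would be infinite.
variable {M} in
theorem Communicating.eq_univ [DecidableEq S] (hM : M.Communicating) {D : Set S}
    (hne : D.Nonempty) (hD : ∀ s ∈ D, ∀ a s', 0 < M.p ⟨s, a⟩ s' → s' ∈ D) : D = Set.univ := by
  by_contra hD'
  obtain ⟨t, ht⟩ := (Set.ne_univ_iff_exists_notMem D).1 hD'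
  obtain ⟨s, hs⟩ := hne
  have hst : s ≠ t := fun h => ht (h ▸ hs)
  have havoid : ∀ (π : Policy A) (n : ℕ), ∀ x ∈ D, M.avoidProb π t n x = 1 := by
    intro π n
    induction n with
    | zero => exact fun x _ => rfl
    | succ n ih =>
      intro x hx
      have hxt : x ≠ t := fun h => ht (h ▸ hx)
      rw [avoidProb, if_neg hxt]
      exact M.next_eq fun y hy => ih y (hD x hx _ y hy)
  have htop : ⨅ π : Policy A, M.expectedHittingTime π s t = ⊤ := by
    refine iInf_eq_top.2 fun π => ?_
    simp only [expectedHittingTime, havoid π _ s hs, ENNReal.ofReal_one]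
    exact ENNReal.tsum_const_eq_top_of_ne_zero one_ne_zero
  refine absurd hM (not_lt.2 (top_le_iff.2 (top_le_iff.1 (htop ▸ ?_))))
  exact le_iSup_of_le s (le_iSup_of_le t (le_iSup_of_le hst le_rfl))

-- A bound at a state passes to each possible successor, at the cost of dividing by the transition
-- probability. The states with a bound uniform in `U` are thus closed under all actions. The factor
-- 2 anticipates discounts at least 1/2.
variable {M} in
theorem Communicating.exists_span_bound [DecidableEq S] (hM : M.Communicating) (R : ℝ) :
    ∃ K : ℝ, ∀ (s₀ s : S) (U : S → ℝ), (∀ x, 0 ≤ U x) → U s₀ = 0 →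
      (∀ z, M.next z U ≤ 2 * (U z.1 + R)) → U s ≤ K := by
  have key : ∀ q : S × S, ∃ K : ℝ, ∀ U : S → ℝ, (∀ x, 0 ≤ U x) → U q.1 = 0 →
      (∀ z, M.next z U ≤ 2 * (U z.1 + R)) → U q.2 ≤ K := by
    rintro ⟨s₀, s⟩
    have huniv := hM.eq_univ (D := {s | ∃ K : ℝ, ∀ U : S → ℝ, (∀ x, 0 ≤ U x) → U s₀ = 0 →
      (∀ z, M.next z U ≤ 2 * (U z.1 + R)) → U s ≤ K}) ⟨s₀, 0, fun U _ h _ => h.le⟩ (by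
        rintro x ⟨K, hK⟩ a y hy
        refine ⟨2 * (K + R) / M.p ⟨x, a⟩ y, fun U h0 h1 h2 => ?_⟩
        rw [le_div_iff₀ hy, mul_comm]
        have h3 : M.p ⟨x, a⟩ y * U y ≤ M.next ⟨x, a⟩ U :=
          Finset.single_le_sum (f := fun y => M.p ⟨x, a⟩ y * U y)
            (fun t _ => mul_nonneg (M.p_nonneg _ t) (h0 t)) (Finset.mem_univ y)
        have h4 := h2 ⟨x, a⟩
        have h5 := hK U h0 h1 h2
        simp only at h4
        linarith)
    exact huniv.ge (Set.mem_univ s)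
  choose K hK using key
  obtain ⟨B, hB⟩ := Finite.exists_le K
  exact ⟨B, fun s₀ s U h0 h1 h2 => (hK (s₀, s) U h0 h1 h2).trans (hB _)⟩

variable [∀ s, Fintype (A s)] [∀ s, Nonempty (A s)]

/-- The discounted Bellman operator is a `γ`-contraction in the sup norm; `π` is greedy for its
fixed point. -/
theorem exists_discounted_solution {γ : ℝ} (h0 : 0 ≤ γ) (h1 : γ < 1) :
    ∃ (V : S → ℝ) (π : Policy A), (∀ z, M.r z + γ * M.next z V ≤ V z.1) ∧
      ∀ s, M.r ⟨s, π s⟩ + γ * M.next ⟨s, π s⟩ V = V s := by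
  let F : (S → ℝ) → (s : S) → A s → ℝ := fun V s a => M.r ⟨s, a⟩ + γ * M.next ⟨s, a⟩ V
  let T : (S → ℝ) → S → ℝ := fun V s => Finset.univ.sup' Finset.univ_nonempty (F V s)
  have hle : ∀ V W s, T V s ≤ T W s + γ * dist V W := by
    intro V W s
    refine Finset.sup'_le _ _ fun a _ => ?_
    have h2 : F W s a ≤ T W s := Finset.le_sup' (F W s) (Finset.mem_univ a)
    have h3 : M.next ⟨s, a⟩ (V - W) ≤ dist V W := by
      rw [← M.next_const ⟨s, a⟩ (dist V W)]
      refine M.next_mono _ fun x => ?_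
      exact (le_abs_self _).trans (dist_le_pi_dist V W x)
    rw [next_sub] at h3
    have h4 := mul_le_mul_of_nonneg_left h3 h0
    simp only [F] at h2 ⊢
    linarith
  have hT : ContractingWith ⟨γ, h0⟩ T := by
    refine ⟨by exact_mod_cast h1, LipschitzWith.of_dist_le_mul fun V W => ?_⟩
    refine (dist_pi_le_iff (mul_nonneg h0 dist_nonneg)).2 fun s => ?_
    rw [Real.dist_eq, abs_le]
    have h2 := hle V W s
    have h3 := hle W V s
    rw [dist_comm W V] at h3
    change -(γ * dist V W) ≤ _ ∧ _ ≤ γ * dist V W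
    exact ⟨by linarith, by linarith⟩
  have hfix : T hT.fixedPoint = hT.fixedPoint := hT.fixedPoint_isFixedPt
  set V := hT.fixedPoint
  have hπ : ∀ s, ∃ a, T V s = F V s a := fun s => by
    obtain ⟨a, -, ha⟩ := Finset.exists_mem_eq_sup' (Finset.univ_nonempty (α := A s)) (F V s)
    exact ⟨a, ha⟩
  choose π hπ using hπ
  refine ⟨V, π, fun z => ?_, fun s => ?_⟩
  · rw [← congrFun hfix z.1]
    exact Finset.le_sup' (F V z.1) (Finset.mem_univ z.2)
  · rw [← congrFun hfix s, hπ s]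

variable {M} in
/-- The vanishing discount argument: the optimality equation of a communicating model has a
solution. -/
theorem Communicating.exists_optimality_solution [DecidableEq S] [Nonempty S]
    (hM : M.Communicating) : ∃ (g : ℝ) (h : S → ℝ) (π : Policy A),
      (∀ z, M.r z + M.next z h ≤ g + h z.1) ∧
      ∀ s, M.r ⟨s, π s⟩ + M.next ⟨s, π s⟩ h = g + h s := by
  set R : ℝ := ‖M.r‖
  have hR : ∀ z, |M.r z| ≤ R := fun z => norm_le_pi_norm M.r z
  obtain ⟨K, hK⟩ := hM.exists_span_bound (2 * R)
  -- Triples are (discount, gain, relative value). Projecting a compact set of solutions gives a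
  -- closed set of discounts; it contains [1/2, 1), hence 1.
  let F : Set (ℝ × ℝ × (S → ℝ)) := ⋃ π : Policy A,
    {q | (∀ z, M.r z + q.1 * M.next z q.2.2 ≤ q.2.1 + q.2.2 z.1) ∧
      ∀ s, M.r ⟨s, π s⟩ + q.1 * M.next ⟨s, π s⟩ q.2.2 = q.2.1 + q.2.2 s}
  have hnc : ∀ z, Continuous fun q : ℝ × ℝ × (S → ℝ) => M.next z q.2.2 :=
    fun z => (M.continuous_next z).comp (by fun_prop)
  have hF : IsClosed F := by
    refine isClosed_iUnion_of_finite fun π => ?_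
    simp only [Set.ofPred_and, Set.ofPred_forall]
    refine (isClosed_iInter fun z => ?_).inter (isClosed_iInter fun s => ?_)
    · have := hnc z
      exact isClosed_le (by fun_prop) (by fun_prop)
    · have := hnc ⟨s, π s⟩
      exact isClosed_eq (by fun_prop) (by fun_prop)
  let B : Set (ℝ × ℝ × (S → ℝ)) :=
    Set.Icc (1 / 2) 1 ×ˢ Set.Icc (-R) R ×ˢ Set.Icc 0 (fun _ => K)
  have hB : IsCompact B := isCompact_Icc.prod (isCompact_Icc.prod isCompact_Icc)
  have himg : IsClosed (Prod.fst '' (B ∩ F)) :=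
    ((hB.inter_right hF).image continuous_fst).isClosed
  have hsub : Set.Ico (1 / 2 : ℝ) 1 ⊆ Prod.fst '' (B ∩ F) := by
    rintro γ ⟨hγ, hγ1⟩
    have hγ0 : 0 ≤ γ := by linarith
    obtain ⟨V, π, hV, hπ⟩ := M.exists_discounted_solution hγ0 hγ1
    obtain ⟨s₀, hs₀⟩ := Finite.exists_min V
    obtain ⟨s₁, hs₁⟩ := Finite.exists_max V
    let U : S → ℝ := V - fun _ => V s₀
    have hU : ∀ z, M.next z U = M.next z V - V s₀ := fun z => by rw [M.next_sub, M.next_const]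
    have hU0 : ∀ s, 0 ≤ U s := fun s => sub_nonneg.2 (hs₀ s)
    have hUs : ∀ s, U s = V s - V s₀ := fun s => rfl
    have hnU : ∀ z, 0 ≤ M.next z U := fun z => M.le_next fun s _ => hU0 s
    have hcle : (1 - γ) * V s₀ ≤ R := by
      have h2 : M.next ⟨s₁, π s₁⟩ V ≤ V s₁ := by
        conv_rhs => rw [← M.next_const ⟨s₁, π s₁⟩ (V s₁)]
        exact M.next_mono _ hs₁
      have h3 := hπ s₁
      have h4 := mul_le_mul_of_nonneg_left h2 hγ0
      have h5 := (abs_le.1 (hR ⟨s₁, π s₁⟩)).2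
      have h6 := mul_le_mul_of_nonneg_left (hs₀ s₁) (sub_nonneg.2 hγ1.le)
      linarith
    have heq : ∀ z, (M.r z + γ * M.next z U) - ((1 - γ) * V s₀ + U z.1) =
        (M.r z + γ * M.next z V) - V z.1 := fun z => by rw [hU, hUs]; ring
    have hineq : ∀ z, M.r z + γ * M.next z U ≤ (1 - γ) * V s₀ + U z.1 := fun z => by
      linarith [heq z, hV z]
    have hge : -R ≤ (1 - γ) * V s₀ := by
      have h2 := hineq ⟨s₀, π s₀⟩
      have h3 := mul_nonneg hγ0 (hnU ⟨s₀, π s₀⟩)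
      have h4 := (abs_le.1 (hR ⟨s₀, π s₀⟩)).1
      have h5 : U s₀ = 0 := sub_self _
      simp only [h5] at h2
      linarith
    have hspan : ∀ s, U s ≤ K := fun s => hK s₀ s U hU0 (sub_self _) fun z => by
      have h2 := hineq z
      have h3 := (abs_le.1 (hR z)).1
      have h4 := mul_le_mul_of_nonneg_right hγ (hnU z)
      linarith
    refine ⟨(γ, (1 - γ) * V s₀, U), ⟨⟨⟨hγ, hγ1.le⟩, ⟨hge, hcle⟩, hU0, hspan⟩,
      Set.mem_iUnion.2 ⟨π, hineq, fun s => ?_⟩⟩, rfl⟩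
    have h2 := heq ⟨s, π s⟩
    have h3 := hπ s
    simp only at h2 ⊢
    linarith
  have hone : (1 : ℝ) ∈ Prod.fst '' (B ∩ F) := by
    refine closure_minimal hsub himg ?_
    rw [closure_Ico (by norm_num)]
    exact ⟨by norm_num, le_rfl⟩
  obtain ⟨⟨γ, g, h⟩, ⟨-, hq⟩, rfl⟩ := hone
  obtain ⟨π, h1, h2⟩ := Set.mem_iUnion.1 hq
  simp only [one_mul] at h1 h2
  exact ⟨g, h, π, h1, h2⟩

end OptimalityEquation

/-! ### Gaps relative to one policy -/

section PolicyGap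

variable {S : Type*} [Fintype S] [DecidableEq S] {A : S → Type*} (M : MDP S A) {π : Policy A}

/-- The gap of a pair in the optimality equation for the gain and the bias of a policy. -/
noncomputable def policyGap (π : Policy A) (z : Σ s, A s) : ℝ :=
  M.gain π z.1 + M.bias π z.1 - M.r z - M.next z (M.bias π)

theorem policyGap_self (s : S) : M.policyGap π ⟨s, π s⟩ = 0 := by
  have := gain_add_bias M π s
  simp only [policyGap]
  linarith

theorem continuous_policyGap [∀ s, Finite (A s)] (z : Σ s, A s) :
    Continuous fun r : (Σ s, A s) → ℝ => (M.withReward r).policyGap π z := by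
  have h := continuous_gainBias M π
  have h1 := (continuous_apply z.1).comp (continuous_fst.comp h)
  have h2 := (continuous_apply z.1).comp (continuous_snd.comp h)
  have h3 := (M.continuous_next z).comp (continuous_snd.comp h)
  exact ((h1.add h2).sub (continuous_apply z)).sub h3

theorem avoidProb_withReward (r : (Σ s, A s) → ℝ) (t : S) (n : ℕ) :
    (M.withReward r).avoidProb π t n = M.avoidProb π t n := by
  induction n with
  | zero => rfl
  | succ n ih =>
    funext s
    rw [avoidProb, avoidProb, ih]
    rfl

variable {M}

theorem Communicating.withReward (hM : M.Communicating) (r : (Σ s, A s) → ℝ) :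
    (M.withReward r).Communicating := by
  simpa only [Communicating, diameter, expectedHittingTime, avoidProb_withReward] using hM

/-- Under a unichain policy `h` and the bias differ by a constant, which cancels in the gap. -/
theorem Unichain.policyGap_eq (hu : M.Unichain π) {g : ℝ} {h : S → ℝ}
    (hr : ∀ s, M.r ⟨s, π s⟩ + M.next ⟨s, π s⟩ h = g + h s) (z : Σ s, A s) :
    M.policyGap π z = g + h z.1 - M.r z - M.next z h := by
  obtain ⟨h1, k, h2⟩ := hu.gain_bias_of_poisson (fun s => (hr s).symm)
  have hb : M.bias π = h - fun _ => k := funext h2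
  rw [policyGap, h1, hb, M.next_sub, M.next_const]
  simp only [Pi.sub_apply]
  ring

theorem Communicating.eq_const_of_next_le (hM : M.Communicating) {f : S → ℝ}
    (hf : ∀ z, M.next z f ≤ f z.1) (x y : S) : f x = f y := by
  obtain ⟨m, -, hm⟩ := Set.exists_min_image Set.univ f Set.finite_univ ⟨x, trivial⟩
  have huniv := hM.eq_univ (D := {s | f s = f m}) ⟨m, rfl⟩ fun s hs a s' hs' =>
    M.eq_of_next_le (fun t _ => hm t trivial) ((hf ⟨s, a⟩).trans hs.le) s' hs'
  have h : ∀ s, f s = f m := fun s => huniv.ge (Set.mem_univ s)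
  rw [h x, h y]

theorem BellmanOptimal.policyGap_nonneg [∀ s, Finite (A s)] (h : M.BellmanOptimal π)
    (z : Σ s, A s) : 0 ≤ M.policyGap π z := by
  have h1 := h.2 z.1
  have h2 := le_ciSup (f := fun a : A z.1 => M.r ⟨z.1, a⟩ + M.next ⟨z.1, a⟩ (M.bias π))
    (Set.finite_range _).bddAbove z.2
  simp only [policyGap]
  change M.r z + M.next z (M.bias π) ≤ _ at h2
  linarith

theorem BellmanOptimal.next_gain_le [∀ s, Finite (A s)] (h : M.BellmanOptimal π)
    (z : Σ s, A s) : M.next z (M.gain π) ≤ M.gain π z.1 := by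
  rw [h.1 z.1]
  exact le_ciSup (f := fun a : A z.1 => M.next ⟨z.1, a⟩ (M.gain π))
    (Set.finite_range _).bddAbove z.2

theorem Unichain.bellmanOptimal [∀ s, Finite (A s)] (hu : M.Unichain π)
    (hgap : ∀ z, 0 ≤ M.policyGap π z) : M.BellmanOptimal π := by
  obtain ⟨g, hg⟩ := hu.exists_gain_eq
  have hgain : M.gain π = fun _ => g := funext hg
  refine ⟨fun s => ?_, fun s => ?_⟩
  · have : Nonempty (A s) := ⟨π s⟩
    simp only [hgain, M.next_const, ciSup_const]
  · have : Nonempty (A s) := ⟨π s⟩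
    refine le_antisymm ?_ (ciSup_le fun a => ?_)
    · rw [gain_add_bias]
      exact le_ciSup (f := fun a : A s => M.r ⟨s, a⟩ + M.next ⟨s, a⟩ (M.bias π))
        (Set.finite_range _).bddAbove (π s)
    · have := hgap ⟨s, a⟩
      simp only [policyGap] at this
      linarith

/-- The function `M.gain π - g` is harmonic under `π` and bounded by the drift of `h - M.bias π`. -/
theorem gain_le {g : ℝ} {h : S → ℝ} (hgap : ∀ z, M.r z + M.next z h ≤ g + h z.1)
    (π : Policy A) (s : S) : M.gain π s ≤ g := by
  have := nonpos_of_le_sub_next (M := M) (π := π) (q := M.gain π - fun _ => g)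
    (f := h - M.bias π) (fun s => by rw [M.next_sub, M.next_const, next_gain]; rfl)
    (fun s => by
      have h1 := gain_add_bias M π s
      have h2 := hgap ⟨s, π s⟩
      rw [M.next_sub]
      simp only [Pi.sub_apply]
      linarith) s
  simp only [Pi.sub_apply] at this
  linarith

end PolicyGap

/-! ### Positive gaps, bonuses and uniqueness -/

section Perturbation

variable {S : Type*} [Fintype S] [DecidableEq S] {A : S → Type*} {M : MDP S A} {π : Policy A}

/-- If only the pairs of a policy have gap zero, then a policy of the same gain has the same bias on
the recurrent class, and no larger bias elsewhere. -/
theorem IsUniqueClass.bias_comparison {C : Set S} (hC : M.IsUniqueClass π C)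
    (hpos : ∀ s a, a ≠ π s → 0 < M.policyGap π ⟨s, a⟩) {ξ : Policy A}
    (hξ : M.gain ξ = M.gain π) :
    (∀ c ∈ C, M.bias ξ c = M.bias π c) ∧ ∀ s, M.bias ξ s ≤ M.bias π s := by
  set f : S → ℝ := M.bias π - M.bias ξ with hf
  have hgap : ∀ s, M.policyGap π ⟨s, ξ s⟩ = f s - M.next ⟨s, ξ s⟩ f := fun s => by
    have := gain_add_bias M ξ s
    rw [hf, M.next_sub, policyGap]
    simp only [Pi.sub_apply, hξ] at this ⊢
    linarith
  have hnonneg : ∀ s a, 0 ≤ M.policyGap π ⟨s, a⟩ := fun s a => by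
    by_cases h : a = π s
    · rw [h, policyGap_self]
    · exact (hpos s a h).le
  obtain ⟨⟨x, hx⟩, -⟩ := hC.1
  obtain ⟨C', -, hC', hmin⟩ :=
    (isClosedUnder_univ (M := M) (π := ξ)).exists_isRecurrentClass_min (f := f) ⟨x, trivial⟩
      fun s _ => by linarith [hgap s, hnonneg s (ξ s)]
  -- On `C'` the function `f` is constant, so the gap of `ξ` vanishes there and positivity forces
  -- `ξ` to agree with `π`. Hence `C'` is closed under `π` and contains `C`.
  have hξπ : ∀ s ∈ C', ξ s = π s := fun s hs => by
    by_contra hne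
    have h1 := hpos s _ hne
    have h2 : M.next ⟨s, ξ s⟩ f = f s := M.next_eq fun t ht =>
      le_antisymm (hmin t (hC'.isClosedUnder s hs t ht) s trivial) (hmin s hs t trivial)
    linarith [hgap s]
  have hcl : M.IsClosedUnder π C' := fun s hs t ht =>
    hC'.isClosedUnder s hs t (by rwa [hξπ s hs])
  obtain ⟨C₁, hsub, hC₁⟩ := hcl.exists_isRecurrentClass hC'.1
  rw [hC.2 C₁ hC₁] at hsub
  obtain ⟨w, hw⟩ := (gain_bias_spec M π).2.2
  obtain ⟨w', hw'⟩ := (gain_bias_spec M ξ).2.2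
  have hfw : ∀ s ∈ C, f s = (w - w') s - M.next ⟨s, π s⟩ (w - w') := fun s hs => by
    have h1 := congrFun hw s
    have h2 := congrFun hw' s
    simp only [Pi.sub_apply, trans_mulVec, hξπ s (hsub hs)] at h1 h2
    rw [hf, M.next_sub]
    simp only [Pi.sub_apply]
    linarith
  have hconst : ∀ s ∈ C, f s = f x := fun s hs =>
    le_antisymm (hmin s (hsub hs) x trivial) (hmin x (hsub hx) s trivial)
  -- A constant that is also a drift on a closed set is zero; `w` and `w'` express the normalisation
  -- of the two biases.
  have h0 : f x = 0 := by
    refine le_antisymm (hC.1.isClosedUnder.drift_nonpos hC.1.1 (f := w - w') fun s hs => ?_) ?_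
    · rw [← hfw s hs, hconst s hs]
    · have := hC.1.isClosedUnder.drift_nonpos hC.1.1 (f := -(w - w')) (c := -f x) fun s hs => by
        rw [← hconst s hs, hfw s hs, M.next_neg]
        simp only [Pi.neg_apply]
        linarith
      linarith
  refine ⟨fun c hc => ?_, fun s => ?_⟩
  · have := hconst c hc
    rw [h0, hf, Pi.sub_apply] at this
    linarith
  · have := hmin x (hsub hx) s trivial
    rw [h0, hf, Pi.sub_apply] at this
    linarith

variable [∀ s, Fintype (A s)] [∀ s, Nonempty (A s)] [Nonempty S]

/-- A unichain policy with positive gaps outside its graph witnesses non-degeneracy. -/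
theorem Communicating.nonDegenerate_of_policyGap_pos (hM : M.Communicating) (hu : M.Unichain π)
    (hpos : ∀ s a, a ≠ π s → 0 < M.policyGap π ⟨s, a⟩) :
    M.NonDegenerate ∧ M.weaklyOptimalPairs = {z | z.2 = π z.1} := by
  obtain ⟨C, hC⟩ := hu.exists_isUniqueClass
  obtain ⟨g, hg⟩ := hu.exists_gain_eq
  have hgap : ∀ z, 0 ≤ M.policyGap π z := fun ⟨s, a⟩ => by
    by_cases h : a = π s
    · rw [h, policyGap_self]
    · exact (hpos s a h).le
  have hineq : ∀ z, M.r z + M.next z (M.bias π) ≤ g + M.bias π z.1 := fun z => by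
    have := hgap z
    rw [policyGap, hg] at this
    linarith
  refine ⟨⟨π, hu.bellmanOptimal hgap, fun ξ hξ => ?_, hu⟩, ?_⟩
  · have hgξ : M.gain ξ = M.gain π := by
      -- The gain of `ξ` is superharmonic under every action, hence constant. Each policy then
      -- satisfies the hypothesis of `gain_le` for the other.
      have hconst := hM.eq_const_of_next_le hξ.next_gain_le
      obtain ⟨x⟩ := ‹Nonempty S›
      have hle : ∀ s, M.gain π s ≤ M.gain ξ x := gain_le (h := M.bias ξ) (fun z => by
        have := hξ.policyGap_nonneg z
        rw [policyGap, hconst z.1 x] at this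
        linarith) π
      funext s
      refine le_antisymm ?_ (by rw [hconst s x]; exact hle s)
      rw [hg]
      exact gain_le hineq ξ s
    obtain ⟨hbC, hbξ⟩ := hC.bias_comparison hpos hgξ
    -- The difference of the biases is superharmonic under `π` and vanishes on `C`, so it is
    -- nonnegative.
    have hbias : M.bias ξ = M.bias π := by
      funext s
      refine le_antisymm (hbξ s) ?_
      obtain ⟨c, hc⟩ := hC.1.1
      have := hC.le_of_next_le (f := M.bias ξ - M.bias π) (fun s => by
        have h1 := hξ.policyGap_nonneg ⟨s, π s⟩
        have h2 := M.policyGap_self (π := π) s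
        rw [policyGap] at h1 h2
        rw [M.next_sub, Pi.sub_apply]
        rw [hgξ] at h1
        simp only at h1 h2
        linarith) hc s
      simp only [Pi.sub_apply, hbC c hc, sub_self] at this
      linarith
    funext s
    by_contra hne
    have h1 := hpos s (ξ s) hne
    have h2 := M.policyGap_self (π := ξ) s
    rw [policyGap, hgξ, hbias] at h2
    rw [policyGap] at h1
    exact h1.ne' h2
  · have hoptGain : M.optGain = M.gain π := by
      funext s
      refine le_antisymm (ciSup_le fun ξ => ?_)
        (le_ciSup (f := fun ξ => M.gain ξ s) (Set.finite_range _).bddAbove π)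
      rw [hg]
      exact gain_le hineq ξ s
    have hopt : M.GainOptimal π := fun s => by rw [hoptGain]
    have hoptBias : M.optBias = M.bias π := by
      funext s
      have : Nonempty {ξ : Policy A // M.GainOptimal ξ} := ⟨⟨π, hopt⟩⟩
      refine le_antisymm (ciSup_le fun ξ => ?_)
        (le_ciSup (f := fun ξ : {ξ : Policy A // M.GainOptimal ξ} => M.bias ξ.1 s)
          (Set.finite_range _).bddAbove ⟨π, hopt⟩)
      exact (hC.bias_comparison hpos (by rw [← hoptGain]; exact funext ξ.2)).2 s
    have hgapeq : M.gap = M.policyGap π := by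
      funext z
      rw [gap, policyGap, hoptGain, hoptBias]
    ext ⟨s, a⟩
    simp only [weaklyOptimalPairs, hgapeq, Set.mem_ofPred_eq]
    refine ⟨fun h => ?_, ?_⟩
    · by_contra hne
      exact (hpos s a hne).ne' h
    · rintro rfl
      exact M.policyGap_self s

omit [Nonempty S] in
/-- Rewarding the pairs of a recurrent class with gap zero makes it the only recurrent class of some
optimal policy. -/
theorem Communicating.exists_isUniqueClass_bonus (hM : M.Communicating) {g : ℝ} {h : S → ℝ}
    (hgap : ∀ z, M.r z + M.next z h ≤ g + h z.1) {C : Set S} (hC : M.IsRecurrentClass π C)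
    (hz : ∀ s ∈ C, M.r ⟨s, π s⟩ + M.next ⟨s, π s⟩ h = g + h s) {bonus : (Σ s, A s) → ℝ}
    (hone : ∀ s ∈ C, bonus ⟨s, π s⟩ = 1) (hzero : ∀ z, ¬(z.1 ∈ C ∧ z.2 = π z.1) → bonus z = 0)
    {δ : ℝ} (hδ : 0 < δ) :
    ∃ ν, M.IsUniqueClass ν C ∧ ∀ z, 0 ≤ (M.withReward (M.r + δ • bonus)).policyGap ν z := by
  obtain ⟨x, hx⟩ := hC.1
  have : Nonempty S := ⟨x⟩
  obtain ⟨g', h', ν, hg', hν⟩ :=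
    (hM.withReward (M.r + δ • bonus)).exists_optimality_solution
  change ∀ z, M.r z + δ * bonus z + M.next z h' ≤ g' + h' z.1 at hg'
  change ∀ s, M.r ⟨s, ν s⟩ + δ * bonus ⟨s, ν s⟩ + M.next ⟨s, ν s⟩ h' = g' + h' s at hν
  -- Staying in `C` under `π` earns `g + δ`, so the optimal gain with the bonus is at least that.
  have hlow : g + δ - g' ≤ 0 := hC.isClosedUnder.drift_nonpos hC.1 (f := h' - h) fun s hs => by
    have h1 := hg' ⟨s, π s⟩
    have h2 := hz s hs
    rw [hone s hs] at h1
    rw [M.next_sub, Pi.sub_apply]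
    simp only at h1
    linarith
  have hclass : ∀ D, M.IsRecurrentClass ν D → D = C := by
    intro D hD
    -- Hence `h - h'` is superharmonic under `ν`, so constant on `D`; its drift vanishes there, and
    -- no pair used in `D` can miss the bonus.
    have hdrift : ∀ s, δ * (1 - bonus ⟨s, ν s⟩) ≤ (h - h') s - M.next ⟨s, ν s⟩ (h - h') :=
      fun s => by
        have h1 := hgap ⟨s, ν s⟩
        have h2 := hν s
        rw [M.next_sub, Pi.sub_apply]
        simp only at h1
        linarith
    have hbonus : ∀ s, bonus ⟨s, ν s⟩ ≤ 1 := fun s => by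
      by_cases hs : s ∈ C ∧ ν s = π s
      · rw [hs.2, hone s hs.1]
      · exact (hzero ⟨s, ν s⟩ hs).trans_le zero_le_one
    have hsuper : ∀ s ∈ D, M.next ⟨s, ν s⟩ (h - h') ≤ (h - h') s := fun s _ => by
      have := mul_nonneg hδ.le (sub_nonneg.2 (hbonus s))
      linarith [hdrift s]
    have hD' : ∀ s ∈ D, s ∈ C ∧ ν s = π s := fun s hs => by
      by_contra hne
      have h1 : bonus ⟨s, ν s⟩ = 0 := hzero _ hne
      have h2 : M.next ⟨s, ν s⟩ (h - h') = (h - h') s := M.next_eq fun t ht =>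
        hD.eq_of_next_le hsuper (hD.isClosedUnder s hs t ht) hs
      have h3 := hdrift s
      rw [h1, h2] at h3
      linarith
    obtain ⟨s, hs⟩ := hD.1
    refine Set.Subset.antisymm (fun t ht => (hD' t ht).1) ?_
    refine hC.subset_of_mem (hD' s hs).1 (fun t ht t' ht' => ?_) hs
    exact hD.isClosedUnder t ht t' (by rwa [(hD' t ht).2])
  obtain ⟨D, -, hD⟩ := (isClosedUnder_univ (M := M) (π := ν)).exists_isRecurrentClass
    ⟨x, trivial⟩
  have hu : M.IsUniqueClass ν C := ⟨hclass D hD ▸ hD, hclass⟩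
  refine ⟨ν, hu, fun z => ?_⟩
  have hu' : (M.withReward (M.r + δ • bonus)).Unichain ν := hu.unichain
  rw [hu'.policyGap_eq (g := g') (h := h') hν z]
  have := hg' z
  change 0 ≤ g' + h' z.1 - (M.r z + δ * bonus z) - M.next z h'
  linarith

omit [Nonempty S] in
/-- A recurrent class all of whose pairs have gap zero is the only recurrent class of some optimal
policy. -/
theorem Communicating.exists_isUniqueClass (hM : M.Communicating) {g : ℝ} {h : S → ℝ}
    (hgap : ∀ z, M.r z + M.next z h ≤ g + h z.1) {C : Set S} (hC : M.IsRecurrentClass π C)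
    (hz : ∀ s ∈ C, M.r ⟨s, π s⟩ + M.next ⟨s, π s⟩ h = g + h s) :
    ∃ ν, M.IsUniqueClass ν C ∧ ∀ z, 0 ≤ M.policyGap ν z := by
  classical
  let bonus : (Σ s, A s) → ℝ := fun z => if z.1 ∈ C ∧ z.2 = π z.1 then 1 else 0
  -- The chain ignores rewards, so the constraint on classes is unaffected by the limit δ → 0, and a
  -- finite union of closed conditions is closed.
  let K : Set ((Σ s, A s) → ℝ) := ⋃ ν : {ν : Policy A // M.IsUniqueClass ν C},
    {r | ∀ z, 0 ≤ (M.withReward r).policyGap ν.1 z}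
  have hK : IsClosed K := by
    refine isClosed_iUnion_of_finite fun ν => ?_
    simp only [Set.ofPred_forall]
    exact isClosed_iInter fun z => isClosed_le continuous_const (M.continuous_policyGap z)
  have hmem : ∀ δ : ℝ, 0 < δ → M.r + δ • bonus ∈ K := by
    intro δ hδ
    obtain ⟨ν, hν, hν'⟩ := hM.exists_isUniqueClass_bonus hgap hC hz (bonus := bonus)
      (fun s hs => if_pos ⟨hs, rfl⟩) (fun z hz => if_neg hz) hδ
    exact Set.mem_iUnion.2 ⟨⟨ν, hν⟩, hν'⟩
  have hlim : Tendsto (fun δ : ℝ => M.r + δ • bonus) (𝓝[>] 0) (𝓝 M.r) := by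
    have : Continuous fun δ : ℝ => M.r + δ • bonus := by fun_prop
    simpa using (this.tendsto 0).mono_left nhdsWithin_le_nhds
  have hr : M.r ∈ K := hK.mem_of_tendsto hlim (eventually_nhdsWithin_of_forall fun δ hδ => hmem δ hδ)
  obtain ⟨⟨ν, hν⟩, hν'⟩ := Set.mem_iUnion.1 hr
  exact ⟨ν, hν, hν'⟩

theorem Communicating.exists_unichain (hM : M.Communicating) :
    ∃ ν, M.Unichain ν ∧ ∀ z, 0 ≤ M.policyGap ν z := by
  obtain ⟨g, h, π, hgap, hπ⟩ := hM.exists_optimality_solution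
  obtain ⟨x⟩ := ‹Nonempty S›
  obtain ⟨C, -, hC⟩ := (isClosedUnder_univ (M := M) (π := π)).exists_isRecurrentClass ⟨x, trivial⟩
  obtain ⟨ν, hν, hν'⟩ := hM.exists_isUniqueClass hgap hC fun s _ => hπ s
  exact ⟨ν, hν.unichain, hν'⟩

-- If the gap vanished at a pair off the graph, switching `π` to it would keep the optimality
-- equation tight. Either the new policy is unichain with class `C`, or it has another class, which
-- becomes the only class of an optimal policy; both contradict uniqueness.
omit [Nonempty S] in
theorem Communicating.policyGap_pos_of_unique (hM : M.Communicating) (hu : M.Unichain π)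
    (hgap : ∀ z, 0 ≤ M.policyGap π z)
    (huniq : ∀ ξ, M.Unichain ξ → (∀ z, 0 ≤ M.policyGap ξ z) → ξ = π) (s : S) (a : A s)
    (ha : a ≠ π s) : 0 < M.policyGap π ⟨s, a⟩ := by
  refine (hgap _).lt_of_ne fun hzero => ?_
  obtain ⟨C, hC⟩ := hu.exists_isUniqueClass
  obtain ⟨g, hg⟩ := hu.exists_gain_eq
  have hineq : ∀ z, M.r z + M.next z (M.bias π) ≤ g + M.bias π z.1 := fun z => by
    have := hgap z
    rw [policyGap, hg] at this
    linarith
  set ξ : Policy A := Function.update π s a with hξ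
  have hξ0 : ∀ t, M.policyGap π ⟨t, ξ t⟩ = 0 := fun t => by
    by_cases ht : t = s
    · subst ht
      rw [hξ, Function.update_self, ← hzero]
    · rw [hξ, Function.update_of_ne ht, policyGap_self]
  have heq : ∀ t, M.r ⟨t, ξ t⟩ + M.next ⟨t, ξ t⟩ (M.bias π) = g + M.bias π t := fun t => by
    have := hξ0 t
    rw [policyGap, hg] at this
    linarith
  by_cases hclass : ∀ C', M.IsRecurrentClass ξ C' → C' = C
  · obtain ⟨C', -, hC'⟩ := (isClosedUnder_univ (M := M) (π := ξ)).exists_isRecurrentClass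
      ⟨s, trivial⟩
    have hξu : M.Unichain ξ := ⟨C, hclass C' hC' ▸ hC', hclass⟩
    have := huniq ξ hξu fun z => by
      rw [hξu.policyGap_eq heq]
      linarith [hineq z]
    apply ha
    rw [← congrFun this s, hξ, Function.update_self]
  · push Not at hclass
    obtain ⟨C', hC', hne⟩ := hclass
    obtain ⟨ν, hν, hν'⟩ := hM.exists_isUniqueClass hineq hC' fun t _ => heq t
    obtain rfl := huniq ν hν.unichain hν'
    exact hne (hC.2 C' hν.1)

/-- Adding a bonus to the pairs of an optimal unichain policy isolates its graph. -/
theorem Communicating.weaklyOptimalPairs_bonus (hM : M.Communicating) (hu : M.Unichain π)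
    (hgap : ∀ z, 0 ≤ M.policyGap π z) [∀ s, DecidableEq (A s)] {δ : ℝ} (hδ : 0 < δ) :
    (M.withReward fun z => M.r z + if z.2 = π z.1 then δ else 0).weaklyOptimalPairs =
      {z | z.2 = π z.1} := by
  obtain ⟨g, hg⟩ := hu.exists_gain_eq
  have hu' : (M.withReward fun z => M.r z + if z.2 = π z.1 then δ else 0).Unichain π := hu
  refine ((hM.withReward _).nonDegenerate_of_policyGap_pos hu' fun s a ha => ?_).2
  -- The bonus covers the whole graph, so it raises the gain by `δ`, keeps `M.bias π` a solution,
  -- and raises every gap off the graph by `δ`.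
  rw [hu'.policyGap_eq (g := g + δ) (h := M.bias π) fun s => ?_]
  · have := hgap ⟨s, a⟩
    rw [policyGap, hg] at this
    change 0 < g + δ + M.bias π s - (M.r ⟨s, a⟩ + if a = π s then δ else 0) -
      M.next ⟨s, a⟩ (M.bias π)
    rw [if_neg ha]
    simp only at this
    linarith
  · have := gain_add_bias M π s
    rw [hg] at this
    change (M.r ⟨s, π s⟩ + if π s = π s then δ else 0) + M.next ⟨s, π s⟩ (M.bias π) =
      g + δ + M.bias π s
    rw [if_pos rfl]
    linarith

end Perturbation

end MDP

/-! ### The equivalence -/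

theorem mainTheorem8 {S : Type*} [Fintype S] [DecidableEq S] [Nonempty S]
    {A : S → Type*} [∀ s, Fintype (A s)] [∀ s, Nonempty (A s)]
    (M : MDP S A) (hM : M.Communicating) :
    M.NonDegenerate ↔
      ∃ ε : ℝ, 0 < ε ∧ ∀ r' : (Σ s, A s) → ℝ, ‖r' - M.r‖ < ε →
        (M.withReward r').weaklyOptimalPairs = M.weaklyOptimalPairs := by
  constructor
  · rintro ⟨π, hπ, huniq, hu⟩
    have hpos := hM.policyGap_pos_of_unique hu hπ.policyGap_nonneg fun ξ hξ hξ' =>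
      huniq ξ (hξ.bellmanOptimal hξ')
    have hev : ∀ᶠ r' in 𝓝 M.r, ∀ z : Σ s, A s, z.2 ≠ π z.1 →
        0 < (M.withReward r').policyGap π z :=
      eventually_all.2 fun z => by
        by_cases hz : z.2 = π z.1
        · exact Eventually.of_forall fun _ h => absurd hz h
        · exact ((M.continuous_policyGap (π := π) z).continuousAt.eventually
            (lt_mem_nhds (hpos z.1 z.2 hz))).mono fun _ h _ => h
    obtain ⟨ε, hε, hball⟩ := Metric.eventually_nhds_iff.1 hev
    refine ⟨ε, hε, fun r' hr' => ?_⟩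
    have hu' : (M.withReward r').Unichain π := hu
    rw [(hM.nonDegenerate_of_policyGap_pos hu hpos).2]
    exact ((hM.withReward r').nonDegenerate_of_policyGap_pos hu' fun s a ha =>
      hball (by rwa [dist_eq_norm]) ⟨s, a⟩ ha).2
  · classical
    rintro ⟨ε, hε, hstable⟩
    obtain ⟨π, hu, hgap⟩ := hM.exists_unichain
    -- A bonus of ε/2 stays within the stability radius, so the weakly-optimal set before the bonus
    -- is already the graph of `ξ`; two such policies then share a graph.
    have hgraph : ∀ ξ, M.Unichain ξ → (∀ z, 0 ≤ M.policyGap ξ z) →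
        M.weaklyOptimalPairs = {z | z.2 = ξ z.1} := fun ξ hξ hξ' => by
      rw [← hM.weaklyOptimalPairs_bonus hξ hξ' (half_pos hε)]
      refine (hstable _ ((pi_norm_lt_iff hε).2 fun z => ?_)).symm
      simp only [Pi.sub_apply, add_sub_cancel_left]
      split_ifs
      · rw [Real.norm_of_nonneg (half_pos hε).le]
        exact half_lt_self hε
      · simpa using hε
    refine (hM.nonDegenerate_of_policyGap_pos hu
      (hM.policyGap_pos_of_unique hu hgap fun ξ hξ hξ' => funext fun s => ?_)).1
    have h : (⟨s, ξ s⟩ : Σ s, A s) ∈ {z : Σ s, A s | z.2 = π z.1} := by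
      rw [← hgraph π hu hgap, hgraph ξ hξ hξ']
      rfl
    exact h
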